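/- Theorem 3. Notation. For $t\in\mathbb R$ let $\|t\|_{\mathbb T}=|\operatorname{Arg}(e^{it})|$ with $\operatorname{Arg}$ valued in $(-\pi,\pi]$. Let $\Delta>0$, $2\le\ell\le s$, $\ell-1\le\tau<\pi/\Delta$, $\rho\ge 0$. A vector $x=(t_1,\dots,t_s)$ of distinct nodes in $(-\frac\pi2,\frac\pi2]$ forms a $(\Delta,\rho,s,\ell,\tau)$-clustered configuration if for each $t_j$ there is a set $x^{(j)}$ of at most $\ell$ of the nodes, containing $t_j$, such that $\Delta\le\|y-t_j\|_{\mathbb T}\le\tau\Delta$ for all $y\in x^{(j)}\setminus\{t_j\}$ and $\|y-t_j\|_{\mathbb T}\ge\rho$ for all nodes $y\notin x^{(j)}$. Let $\mathcal G_\Delta=\{k\Delta:\ k\in\mathbb Z,\ |k|\le\lfloor\frac{\pi}{2\Delta}\rfloor\}$, and let $\mathcal R(\Delta,\rho,s,\ell,\tau)$ be the set of measures $\mu=\sum_{j=1}^s a_j\delta_{t_j}$ with $a_j\in\mathbb C$, $t_j\in\mathcal G_\Delta$ and $(t_1,\dots,t_s)$ a $(\Delta,\rho,s,\ell,\tau)$-clustered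 configuration. Write $\widehat\mu(\omega)=\sum_j a_je^{i\omega t_j}$, let $\|\mu\|_2$ be the $\ell_2$ norm of the amplitudes of a finitely supported measure $\mu$, and let $\|f\|_{2,\Omega}^2=\frac1{2\Omega}\int_{-\Omega}^{\Omega}|f(\omega)|^2\,d\omega$ on $L_2([-\Omega,\Omega])$. For a class $\mathcal R$ of such measures and $\Omega,\varepsilon>0$, the minimax error is $$\mathcal E(\mathcal R,\Omega,\varepsilon)=\inf_{\widetilde\mu}\ \sup_{\mu\in\mathcal R}\ \sup_{e\in L_2([-\Omega,\Omega]),\ \|e\|_{2,\Omega}\le\varepsilon}\ \big\|\widetilde\mu(\widehat\mu+e)-\mu\big\|_2,$$ the infimum being over all maps $\widetilde\mu:L_2([-\Omega,\Omega])\to\mathcal R$. Put $\mathrm{SRF}=\frac{\pi}{\Delta\Omega}$. Statement. Let $2\le\ell\le s$ and $\varepsilon>0$. (1) There is a constant $C_{s,\ell}>0$ depending only on $s$ and $\ell$ such that for any $\rho\ge0$ (with $\rho>0$ unless $\ell=s$), any $\tau\ge\ell-1$ and any $M\ge\pi$ there exists $\alpha\ge M$ such that, for all sufficiently small $\Delta>0$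 for which $\mathcal R(\Delta,\rho,s,\ell,\tau)$ is non-empty, and for $\Omega>0$ with $\mathrm{SRF}=\alpha$, $$\mathcal E\big(\mathcal R(\Delta,\rho,s,\ell,\tau),\Omega,\varepsilon\big)\le C_{s,\ell}\,\mathrm{SRF}^{2\ell-1}\,\varepsilon .$$ (2) There are an absolute constant $\beta>1$, a constant $C_\ell>0$ depending only on $\ell$, and $\rho'>0$, $\tau'\ge\ell-1$ depending only on $s,\ell$, such that for every $0<\Delta<\frac{\pi}{2(2\ell-1)}$ for which $\mathcal G_\Delta\cap(-\frac\pi2,\frac\pi2]$ has at least $s$ points, the class $\mathcal R(\Delta,\rho',s,\ell,\tau')$ is non-empty, and for every $\Omega>0$ with $\mathrm{SRF}>\beta$ $$\mathcal E\big(\mathcal R(\Delta,\rho',s,\ell,\tau'),\Omega,\varepsilon\big)\ge C_\ell\,\mathrm{SRF}^{2\ell-1}\,\varepsilon .$$ -/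

import Mathlib

open MeasureTheory Set Filter Topology
open scoped ENNReal

noncomputable section

namespace SuperRes

/-- Wrap-around distance `‖t‖_𝕋 = |Arg (exp (i t))|`, with `Arg` valued in `(-π, π]`. -/
def wrapDist (t : ℝ) : ℝ := |Complex.arg (Complex.exp (t * Complex.I))|

/-- The vector `x` of `s` distinct nodes in `(-π/2, π/2]` forms a
`(Δ, ρ, s, ℓ, τ)`-clustered configuration. As the nodes are distinct, the cluster of the node
`x j` is given by its set of indices. -/
structure IsClustered (Δ ρ : ℝ) (s ℓ : ℕ) (τ : ℝ) (x : Fin s → ℝ) : Prop where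
  delta_pos : 0 < Δ
  two_le : 2 ≤ ℓ
  le_s : ℓ ≤ s
  le_tau : (ℓ : ℝ) - 1 ≤ τ
  tau_lt : τ < Real.pi / Δ
  rho_nonneg : 0 ≤ ρ
  injective : Function.Injective x
  mem_Ioc : ∀ j, x j ∈ Ioc (-(Real.pi / 2)) (Real.pi / 2)
  cluster : ∀ j, ∃ c : Finset (Fin s), j ∈ c ∧ c.card ≤ ℓ ∧
    (∀ i ∈ c, i ≠ j → Δ ≤ wrapDist (x i - x j) ∧ wrapDist (x i - x j) ≤ τ * Δ) ∧
    (∀ i ∉ c, ρ ≤ wrapDist (x i - x j))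

/-- The grid `{k Δ : k = -⌊π/(2Δ)⌋, …, ⌊π/(2Δ)⌋}`. -/
def grid (Δ : ℝ) : Set ℝ :=
  {t | ∃ k : ℤ, -⌊Real.pi / (2 * Δ)⌋ ≤ k ∧ k ≤ ⌊Real.pi / (2 * Δ)⌋ ∧ t = k * Δ}

/-- Finite complex point measures on the line: the finitely supported `μ` stands for
`∑ t, μ t • δ_t`, and `Finsupp.single t a` for `a • δ_t`. -/
abbrev PointMeasure : Type := ℝ →₀ ℂ

/-- The class of measures `∑ j, a j • δ_(x j)` whose nodes lie on the grid and form a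
`(Δ, ρ, s, ℓ, τ)`-clustered configuration; the amplitudes are arbitrary complex numbers. -/
def clusteredClass (Δ ρ : ℝ) (s ℓ : ℕ) (τ : ℝ) : Set PointMeasure :=
  {μ | ∃ (x : Fin s → ℝ) (a : Fin s → ℂ), (∀ j, x j ∈ grid Δ) ∧ IsClustered Δ ρ s ℓ τ x ∧
    μ = ∑ j, Finsupp.single (x j) (a j)}

/-- The discrete `ℓ²` norm of the amplitudes. -/
def coeffNorm (μ : PointMeasure) : ℝ := √(μ.sum fun _ a => ‖a‖ ^ 2)

/-- The Fourier transform `ω ↦ ∑ j, a j * exp (i ω t j)`. -/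
def fourier (μ : PointMeasure) (ω : ℝ) : ℂ :=
  μ.sum fun t a => a * Complex.exp (Complex.I * ω * t)

/-- Normalized Lebesgue measure `(2Ω)⁻¹ dω` on the band `[-Ω, Ω]`. -/
def bandMeasure (Ω : ℝ) : Measure ℝ :=
  ENNReal.ofReal (1 / (2 * Ω)) • volume.restrict (Icc (-Ω) Ω)

instance (Ω : ℝ) : IsFiniteMeasure (bandMeasure Ω) := by
  refine ⟨?_⟩
  simp only [bandMeasure, Measure.smul_apply, smul_eq_mul, Measure.restrict_apply_univ,
    Real.volume_Icc]
  exact ENNReal.mul_lt_top ENNReal.ofReal_lt_top ENNReal.ofReal_lt_top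

/-- The measurement space `L²([-Ω, Ω])`, with `‖f‖² = (2Ω)⁻¹ ∫_{-Ω}^{Ω} |f|²`. -/
abbrev Band (Ω : ℝ) : Type := Lp ℂ 2 (bandMeasure Ω)

theorem integral_bandMeasure {Ω : ℝ} (hΩ : 0 < Ω) (g : ℝ → ℝ) :
    ∫ ω, g ω ∂(bandMeasure Ω) = 1 / (2 * Ω) * ∫ ω in (-Ω)..Ω, g ω := by
  rw [bandMeasure, integral_smul_measure, ENNReal.toReal_ofReal (by positivity), smul_eq_mul,
    intervalIntegral.integral_of_le (by linarith), integral_Icc_eq_integral_Ioc]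

theorem band_norm_sq {Ω : ℝ} (hΩ : 0 < Ω) (f : Band Ω) :
    ‖f‖ ^ 2 = 1 / (2 * Ω) * ∫ ω in (-Ω)..Ω, ‖f ω‖ ^ 2 := by
  have h := congrArg RCLike.re (L2.inner_def (𝕜 := ℂ) f f)
  rw [inner_self_eq_norm_sq] at h
  rw [h, ← integral_re (L2.integrable_inner f f)]
  simp only [inner_self_eq_norm_sq]
  exact integral_bandMeasure hΩ _

theorem continuous_fourier (μ : PointMeasure) : Continuous (fourier μ) := by
  unfold fourier Finsupp.sum
  fun_prop

theorem memLp_fourier (μ : PointMeasure) (Ω : ℝ) : MemLp (fourier μ) 2 (bandMeasure Ω) := by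
  refine MemLp.of_bound (C := ∑ t ∈ μ.support, ‖μ t‖)
    (continuous_fourier μ).aestronglyMeasurable (Eventually.of_forall fun ω => ?_)
  refine (norm_sum_le _ _).trans (Finset.sum_le_sum fun t _ => ?_)
  have h : Complex.I * ω * t = ((ω * t : ℝ) : ℂ) * Complex.I := by push_cast; ring
  rw [norm_mul, h, Complex.norm_exp_ofReal_mul_I, mul_one]

/-- The restriction of the Fourier transform to the band, as an element of `L²([-Ω, Ω])`. -/
def bandFourier (μ : PointMeasure) (Ω : ℝ) : Band Ω := (memLp_fourier μ Ω).toLp (fourier μ)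

/-- The minimax error: the infimum over all maps `est` from the measurement space to the class
`R` of the worst-case error `‖est (μ̂ + e) - μ‖₂` over `μ ∈ R` and noises `e` with `‖e‖ ≤ ε`. -/
def minimaxError (R : Set PointMeasure) (Ω ε : ℝ) : ℝ≥0∞ :=
  ⨅ est : Band Ω → R, ⨆ μ ∈ R, ⨆ e : Band Ω, ⨆ _ : ‖e‖ ≤ ε,
    ENNReal.ofReal (coeffNorm ((est (bandFourier μ Ω + e) : PointMeasure) - μ))

/-- The super-resolution factor `π / (Δ Ω)`. -/
def SRF (Δ Ω : ℝ) : ℝ := Real.pi / (Δ * Ω)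

end SuperRes

end

/-!
Both bounds compare two measures `μ`, `ν` of the class through their difference, a measure on at
most `2 s` grid nodes.

*Upper bound.* An estimator may return any measure of the class consistent with the data
(`minimaxError_le`), so it suffices to bound the amplitudes of `μ - ν` by the size of its Fourier
transform on the band. For a node `t`, apply to the transform the difference operators
`f ↦ exp (-i v u) f (· + v) - f`, one for every other node `u`, with steps
`v = min (Ω / m) (π / |t - u|)`, where `m = 2 (s + 1)` exceeds the number of nodes. They annihilate
all exponentials except that of `t`, and their total shift is at most `Ω`, so `L²([-Ω, Ω])` controls
what remains on `[-Ω, 0]` (`norm_apply_mul_prod_diffSymbol_le`). The amplitude at `t` gets multiplied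
by factors `exp (i v (t - u)) - 1`, of modulus at least `2` if `|t - u| ≥ m π / Ω`, and at least a
multiple of `Ω |t - u| ≥ Ω Δ` otherwise. The `m π / Ω`-neighbourhood of `t` contains at most `ℓ` nodes
of each configuration, because `m π / Ω` is proportional to `Δ` for a fixed super-resolution factor and
hence is at most `ρ / 2` for small `Δ`; if `ℓ = s` the count is trivial. So at most `2 ℓ - 1` factors are small, which gives the
exponent (`norm_apply_le_of_card_near_le`, `coeffNorm_sub_le`). This works with `α = M`.

*Lower bound.* The measure with transform `c (1 - exp (i ω Δ)) ^ (2 ℓ - 1)` has binomial amplitudes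
on `2 ℓ` consecutive grid points, and transform at most `c (Ω Δ) ^ (2 ℓ - 1)` on the band. Its parts on
the even and on the odd grid points are, up to a sign, two measures of the class with nearly equal data
(`fourier_parityPart_sub`), which no estimator can separate (`le_minimaxError`). Each of the two
configurations of `ℓ` nodes is completed with distant nodes of zero amplitude
(`exists_spread_superset`).
-/

noncomputable section

namespace SuperRes

/-! ### Fourier transforms and coefficients of point measures -/

theorem bandFourier_norm_sq (μ : PointMeasure) {Ω : ℝ} (hΩ : 0 < Ω) :
    ‖bandFourier μ Ω‖ ^ 2 = 1 / (2 * Ω) * ∫ ω in (-Ω)..Ω, ‖fourier μ ω‖ ^ 2 := by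
  rw [band_norm_sq hΩ, ← integral_bandMeasure hΩ, ← integral_bandMeasure hΩ]
  refine integral_congr_ae ?_
  filter_upwards [(memLp_fourier μ Ω).coeFn_toLp] with ω hω
  rw [bandFourier, hω]

theorem fourier_eq_sum {μ : PointMeasure} {N : Finset ℝ} (h : μ.support ⊆ N) (ω : ℝ) :
    fourier μ ω = ∑ t ∈ N, μ t * Complex.exp (Complex.I * ω * t) :=
  Finsupp.sum_of_support_subset _ h _ (by simp)

theorem fourier_sub (μ ν : PointMeasure) : fourier (μ - ν) = fourier μ - fourier ν := by
  funext ω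
  exact Finsupp.sum_sub_index (fun t a b => sub_mul a b _)

theorem bandFourier_sub (μ ν : PointMeasure) (Ω : ℝ) :
    bandFourier (μ - ν) Ω = bandFourier μ Ω - bandFourier ν Ω := by
  rw [bandFourier, bandFourier, bandFourier, ← MemLp.toLp_sub]
  simp only [fourier_sub]

theorem norm_apply_le_coeffNorm (μ : PointMeasure) (t : ℝ) : ‖μ t‖ ≤ coeffNorm μ := by
  refine Real.le_sqrt_of_sq_le ?_
  by_cases ht : t ∈ μ.support
  · exact Finset.single_le_sum (f := fun t => ‖μ t‖ ^ 2) (fun _ _ => by positivity) ht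
  · rw [Finsupp.notMem_support_iff.mp ht]
    rw [norm_zero, zero_pow two_ne_zero]
    exact Finset.sum_nonneg fun _ _ => by positivity

theorem coeffNorm_le_of_forall_norm_apply_le {μ : PointMeasure} {B : ℝ} {n : ℕ} (hB : 0 ≤ B)
    (hn : μ.support.card ≤ n) (h : ∀ t ∈ μ.support, ‖μ t‖ ≤ B) : coeffNorm μ ≤ n * B := by
  refine Real.sqrt_le_iff.mpr ⟨by positivity, ?_⟩
  calc (μ.sum fun _ a => ‖a‖ ^ 2) ≤ ∑ _t ∈ μ.support, B ^ 2 :=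
        Finset.sum_le_sum fun t ht => pow_le_pow_left₀ (norm_nonneg _) (h t ht) 2
    _ = μ.support.card * B ^ 2 := by simp
    _ ≤ n * B ^ 2 := by gcongr
    _ ≤ (n * B) ^ 2 := by
        rw [mul_pow]
        gcongr
        exact_mod_cast Nat.le_self_pow two_ne_zero n

/-! ### Isolating one exponential with difference operators -/

/-- The exponential sum `ω ↦ ∑ x ∈ N, c x * exp (i ω x)`. -/
def expSum (N : Finset ℝ) (c : ℝ → ℂ) (ω : ℝ) : ℂ :=
  ∑ x ∈ N, c x * Complex.exp (Complex.I * ω * x)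

theorem continuous_expSum (N : Finset ℝ) (c : ℝ → ℂ) : Continuous (expSum N c) := by
  unfold expSum
  fun_prop

/-- The multiplier `exp (i v (x - u)) - 1` by which the difference operator
`f ↦ exp (-i v u) f (· + v) - f` acts on the exponential of frequency `x`; it vanishes at
`x = u`. -/
def diffSymbol (v u x : ℝ) : ℂ := Complex.exp (Complex.I * (v * (x - u) : ℝ)) - 1

theorem diffSymbol_self (v u : ℝ) : diffSymbol v u u = 0 := by simp [diffSymbol]

theorem expSum_mul_diffSymbol (N : Finset ℝ) (c : ℝ → ℂ) (v u ω : ℝ) :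
    expSum N (fun x => c x * diffSymbol v u x) ω =
      Complex.exp (-(Complex.I * (v * u))) * expSum N c (ω + v) - expSum N c ω := by
  simp only [expSum, Finset.mul_sum, ← Finset.sum_sub_distrib, diffSymbol]
  refine Finset.sum_congr rfl fun x _ => ?_
  have h : Complex.exp (Complex.I * (v * (x - u) : ℝ)) * Complex.exp (Complex.I * ω * x) =
      Complex.exp (-(Complex.I * (v * u))) * Complex.exp (Complex.I * (ω + v : ℝ) * x) := by
    rw [← Complex.exp_add, ← Complex.exp_add]
    congr 1
    push_cast
    ring
  linear_combination c x * h

theorem integral_expSum_mul_diffSymbol_le (N : Finset ℝ) (c : ℝ → ℂ) {v : ℝ} (u : ℝ)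
    (hv : 0 ≤ v) {a b : ℝ} (hab : a ≤ b) :
    ∫ ω in a..b, ‖expSum N (fun x => c x * diffSymbol v u x) ω‖ ^ 2 ≤
      4 * ∫ ω in a..(b + v), ‖expSum N c ω‖ ^ 2 := by
  have hc : ∀ c, Continuous fun ω => ‖expSum N c ω‖ ^ 2 := fun c =>
    ((continuous_expSum N c).norm.pow 2)
  have hint : ∀ p q, IntervalIntegrable (fun ω => ‖expSum N c ω‖ ^ 2) volume p q :=
    fun p q => (hc c).intervalIntegrable p q
  have hint' : IntervalIntegrable (fun ω => ‖expSum N c (ω + v)‖ ^ 2) volume a b :=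
    ((hc c).comp (continuous_add_const v)).intervalIntegrable a b
  have hpt : ∀ ω, ‖expSum N (fun x => c x * diffSymbol v u x) ω‖ ^ 2 ≤
      2 * ‖expSum N c (ω + v)‖ ^ 2 + 2 * ‖expSum N c ω‖ ^ 2 := fun ω => by
    have hn : ‖Complex.exp (-(Complex.I * (v * u)))‖ = 1 := by
      have : -(Complex.I * (v * u)) = ((-(v * u) : ℝ) : ℂ) * Complex.I := by push_cast; ring
      rw [this, Complex.norm_exp_ofReal_mul_I]
    have h := norm_sub_le (Complex.exp (-(Complex.I * (v * u))) * expSum N c (ω + v))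
      (expSum N c ω)
    rw [← expSum_mul_diffSymbol, norm_mul, hn, one_mul] at h
    have h2 := pow_le_pow_left₀ (norm_nonneg _) h 2
    nlinarith [sq_nonneg (‖expSum N c (ω + v)‖ - ‖expSum N c ω‖)]
  calc _ ≤ ∫ ω in a..b, (2 * ‖expSum N c (ω + v)‖ ^ 2 + 2 * ‖expSum N c ω‖ ^ 2) :=
        intervalIntegral.integral_mono_on hab ((hc _).intervalIntegrable a b)
          ((hint'.const_mul 2).add ((hint a b).const_mul 2)) fun ω _ => hpt ω
    _ = 2 * (∫ ω in (a + v)..(b + v), ‖expSum N c ω‖ ^ 2) +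
          2 * ∫ ω in a..b, ‖expSum N c ω‖ ^ 2 := by
        rw [intervalIntegral.integral_add (hint'.const_mul 2) ((hint a b).const_mul 2),
          intervalIntegral.integral_const_mul, intervalIntegral.integral_const_mul,
          intervalIntegral.integral_comp_add_right (fun ω => ‖expSum N c ω‖ ^ 2)]
    _ ≤ 2 * (∫ ω in a..(b + v), ‖expSum N c ω‖ ^ 2) +
          2 * ∫ ω in a..(b + v), ‖expSum N c ω‖ ^ 2 := by
        have hnn : ∀ (J : Measure ℝ), 0 ≤ᵐ[J] fun ω => ‖expSum N c ω‖ ^ 2 :=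
          fun J => Eventually.of_forall fun ω => by positivity
        gcongr
        · exact intervalIntegral.integral_mono_interval (by linarith) (by linarith) le_rfl
            (hnn _) (hint _ _)
        · exact intervalIntegral.integral_mono_interval le_rfl hab (by linarith)
            (hnn _) (hint _ _)
    _ = _ := by ring

theorem integral_expSum_mul_prod_diffSymbol_le (N P : Finset ℝ) (v : ℝ → ℝ)
    (hv : ∀ u ∈ P, 0 ≤ v u) {a b : ℝ} (hab : a ≤ b) (c : ℝ → ℂ) :
    ∫ ω in a..b, ‖expSum N (fun x => c x * ∏ u ∈ P, diffSymbol (v u) u x) ω‖ ^ 2 ≤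
      4 ^ P.card * ∫ ω in a..(b + ∑ u ∈ P, v u), ‖expSum N c ω‖ ^ 2 := by
  induction P using Finset.induction_on generalizing c with
  | empty => simp
  | insert u P hu ih =>
    have hvP : ∀ w ∈ P, 0 ≤ v w := fun w hw => hv w (Finset.mem_insert_of_mem hw)
    have h1 := ih hvP (fun x => c x * diffSymbol (v u) u x)
    have h2 := integral_expSum_mul_diffSymbol_le N c u (hv u (Finset.mem_insert_self u P))
      (hab.trans (le_add_of_nonneg_right (Finset.sum_nonneg hvP)))
    simp only [Finset.prod_insert hu, Finset.sum_insert hu, Finset.card_insert_of_notMem hu,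
      ← mul_assoc]
    calc _ ≤ _ := h1
      _ ≤ 4 ^ P.card * _ := mul_le_mul_of_nonneg_left h2 (by positivity)
      _ = _ := by rw [add_comm (v u), ← add_assoc, pow_succ]; ring

/-- A single amplitude is controlled by the data on the band: the difference operators attached
to the other nodes annihilate every other exponential, and shift the frequency by at most `Ω` in
total, so that they map data on `[-Ω, Ω]` to data on `[-Ω, 0]`. -/
theorem norm_apply_mul_prod_diffSymbol_le {ν : PointMeasure} {N : Finset ℝ}
    (hN : ν.support ⊆ N) {t : ℝ} (ht : t ∈ N) {Ω : ℝ} (hΩ : 0 < Ω) (v : ℝ → ℝ)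
    (hv : ∀ u ∈ N.erase t, 0 ≤ v u) (hsum : ∑ u ∈ N.erase t, v u ≤ Ω) :
    ‖ν t‖ * ∏ u ∈ N.erase t, ‖diffSymbol (v u) u t‖ ≤
      2 ^ N.card * ‖bandFourier ν Ω‖ := by
  have h := integral_expSum_mul_prod_diffSymbol_le N (N.erase t) v hv
    (show -Ω ≤ 0 by linarith) ν
  have hsingle : ∀ ω : ℝ,
      ‖expSum N (fun x => ν x * ∏ u ∈ N.erase t, diffSymbol (v u) u x) ω‖ =
        ‖ν t‖ * ∏ u ∈ N.erase t, ‖diffSymbol (v u) u t‖ := fun ω => by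
    have hexp : ‖Complex.exp (Complex.I * ω * t)‖ = 1 := by
      have : Complex.I * ω * t = ((ω * t : ℝ) : ℂ) * Complex.I := by push_cast; ring
      rw [this, Complex.norm_exp_ofReal_mul_I]
    rw [expSum, Finset.sum_eq_single_of_mem t ht, norm_mul, hexp, mul_one, norm_mul, norm_prod]
    intro x hx hxt
    have h0 : ∏ u ∈ N.erase t, diffSymbol (v u) u x = 0 :=
      Finset.prod_eq_zero (Finset.mem_erase.mpr ⟨hxt, hx⟩) (diffSymbol_self _ _)
    rw [h0, mul_zero, zero_mul]
  simp only [hsingle, intervalIntegral.integral_const, smul_eq_mul] at h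
  have hf : ∀ ω, expSum N ν ω = fourier ν ω := fun ω => (fourier_eq_sum hN ω).symm
  simp only [hf, zero_add] at h
  have hmono : ∫ ω in (-Ω)..(∑ u ∈ N.erase t, v u), ‖fourier ν ω‖ ^ 2 ≤
      ∫ ω in (-Ω)..Ω, ‖fourier ν ω‖ ^ 2 :=
    intervalIntegral.integral_mono_interval le_rfl
      (by linarith [Finset.sum_nonneg hv]) hsum
      (Eventually.of_forall fun ω => by positivity)
      (((continuous_fourier ν).norm.pow 2).intervalIntegrable _ _)
  have hband : ∫ ω in (-Ω)..Ω, ‖fourier ν ω‖ ^ 2 = 2 * Ω * ‖bandFourier ν Ω‖ ^ 2 := by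
    rw [bandFourier_norm_sq ν hΩ]
    field_simp
  have hcard : N.card = (N.erase t).card + 1 := (Finset.card_erase_add_one ht).symm
  refine le_of_sq_le_sq ?_ (by positivity)
  have h4 : ((2 : ℝ) ^ N.card) ^ 2 = 4 * 4 ^ (N.erase t).card := by
    rw [hcard, ← pow_mul, mul_comm, pow_mul, pow_succ]
    norm_num
    ring
  rw [mul_pow (2 ^ N.card), h4]
  have h5 : (4 : ℝ) ^ (N.erase t).card * ∫ ω in (-Ω)..(∑ u ∈ N.erase t, v u), ‖fourier ν ω‖ ^ 2
      ≤ 4 ^ (N.erase t).card * (2 * Ω * ‖bandFourier ν Ω‖ ^ 2) :=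
    mul_le_mul_of_nonneg_left (hmono.trans_eq hband) (by positivity)
  have h6 := h.trans h5
  have hp : (0 : ℝ) ≤ 4 ^ (N.erase t).card * ‖bandFourier ν Ω‖ ^ 2 := by positivity
  refine le_of_mul_le_mul_left ?_ hΩ
  nlinarith [mul_nonneg hΩ.le hp]

/-- With the step `min (Ω / m) (π / |t - u|)` the phase `v |t - u|` never exceeds `π`, so the
multiplier is bounded below by Jordan's inequality. -/
theorem le_norm_diffSymbol {Ω m t u : ℝ} (hΩ : 0 < Ω) (hm : 0 < m) (htu : t ≠ u) :
    2 * min (Ω * |t - u| / (m * Real.pi)) 1 ≤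
      ‖diffSymbol (min (Ω / m) (Real.pi / |t - u|)) u t‖ := by
  have hd : 0 < |t - u| := abs_pos.mpr (sub_ne_zero.mpr htu)
  have hπ := Real.pi_pos
  set v := min (Ω / m) (Real.pi / |t - u|) with hv
  have hv0 : 0 ≤ v := by positivity
  have hvd : v * |t - u| = Real.pi * min (Ω * |t - u| / (m * Real.pi)) 1 := by
    rw [hv, min_mul_of_nonneg _ _ hd.le, mul_min_of_nonneg _ _ hπ.le]
    congr 1 <;> field_simp
  have hle : v * |t - u| ≤ Real.pi := by
    rw [hvd]
    exact mul_le_of_le_one_right hπ.le (min_le_right _ _)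
  have hnorm : ‖diffSymbol v u t‖ = |2 * Real.sin (v * |t - u| / 2)| := by
    rw [diffSymbol, Complex.norm_exp_I_mul_ofReal_sub_one, Real.norm_eq_abs]
    rcases abs_cases (t - u) with ⟨h, _⟩ | ⟨h, _⟩ <;> rw [h]
    rw [mul_neg, neg_div, Real.sin_neg, mul_neg, abs_neg]
  have hsin := Real.mul_le_sin (x := v * |t - u| / 2) (by positivity) (by linarith)
  rw [hnorm]
  refine le_trans ?_ (le_abs_self _)
  have : 2 / Real.pi * (v * |t - u| / 2) = min (Ω * |t - u| / (m * Real.pi)) 1 := by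
    rw [hvd]
    field_simp
  linarith

/-- The stability estimate: if all nodes are `Δ`-separated from `t` and at most `p` of them lie
within `m π / Ω` of `t`, only those `p` cost a factor proportional to `1 / (Ω Δ)`. -/
theorem norm_apply_le_of_card_near_le {ν : PointMeasure} {N : Finset ℝ} (hN : ν.support ⊆ N)
    {t : ℝ} (ht : t ∈ N) {Ω m Δ q : ℝ} {p : ℕ} (hΩ : 0 < Ω) (hm : 0 < m) (hNm : N.card ≤ m)
    (hsep : ∀ u ∈ N, u ≠ t → Δ ≤ |t - u|) (hq0 : 0 < q) (hq1 : q ≤ 1)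
    (hq : q ≤ 2 * (Ω * Δ / (m * Real.pi)))
    (hnear : ((N.erase t).filter fun u => |t - u| < m * Real.pi / Ω).card ≤ p) :
    ‖ν t‖ * q ^ p ≤ 2 ^ N.card * ‖bandFourier ν Ω‖ := by
  have hπ := Real.pi_pos
  set v : ℝ → ℝ := fun u => min (Ω / m) (Real.pi / |t - u|)
  have hv : ∀ u ∈ N.erase t, 0 ≤ v u := fun u _ => by simp only [v]; positivity
  have hsum : ∑ u ∈ N.erase t, v u ≤ Ω :=
    calc ∑ u ∈ N.erase t, v u ≤ ∑ _u ∈ N.erase t, Ω / m :=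
          Finset.sum_le_sum fun u _ => min_le_left _ _
      _ = (N.erase t).card * (Ω / m) := by simp
      _ ≤ m * (Ω / m) := by
          gcongr
          exact le_trans (by exact_mod_cast Finset.card_erase_le) hNm
      _ = Ω := by field_simp
  refine le_trans ?_ (norm_apply_mul_prod_diffSymbol_le hN ht hΩ v hv hsum)
  gcongr
  calc q ^ p ≤ q ^ ((N.erase t).filter fun u => |t - u| < m * Real.pi / Ω).card :=
        pow_le_pow_of_le_one hq0.le hq1 hnear
    _ = ∏ u ∈ N.erase t, if |t - u| < m * Real.pi / Ω then q else 1 := by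
        rw [Finset.prod_ite]
        simp
    _ ≤ _ := by
        refine Finset.prod_le_prod (fun u _ => by split_ifs <;> positivity) fun u hu => ?_
        obtain ⟨hut, huN⟩ := Finset.mem_erase.mp hu
        refine le_trans ?_ (le_norm_diffSymbol hΩ hm (Ne.symm hut))
        split_ifs with h
        · rw [mul_min_of_nonneg _ _ zero_le_two]
          refine le_min (hq.trans ?_) (by linarith)
          gcongr
          exact hsep u huN hut
        · have : 1 ≤ Ω * |t - u| / (m * Real.pi) := by
            rw [one_le_div (by positivity)]
            rwa [not_lt, div_le_iff₀' hΩ] at h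
          rw [min_eq_right this]
          norm_num

/-! ### Clustered configurations on the grid -/

theorem wrapDist_of_mem_Ioc {x y : ℝ} (hx : x ∈ Ioc (-(Real.pi / 2)) (Real.pi / 2))
    (hy : y ∈ Ioc (-(Real.pi / 2)) (Real.pi / 2)) : wrapDist (x - y) = |x - y| := by
  rw [wrapDist, Complex.arg_exp_mul_I, (toIocMod_eq_self Real.two_pi_pos).mpr]
  constructor <;> linarith [hx.1, hx.2, hy.1, hy.2]

theorem le_abs_sub_of_mem_grid {Δ t u : ℝ} (hΔ : 0 < Δ) (ht : t ∈ grid Δ) (hu : u ∈ grid Δ)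
    (h : u ≠ t) : Δ ≤ |t - u| := by
  obtain ⟨k, -, -, rfl⟩ := ht
  obtain ⟨n, -, -, rfl⟩ := hu
  rw [← sub_mul, abs_mul, abs_of_pos hΔ]
  refine le_mul_of_one_le_left hΔ.le ?_
  have hkn : k - n ≠ 0 := sub_ne_zero.mpr fun e => h (by rw [e])
  exact_mod_cast Int.one_le_abs hkn

theorem IsClustered.card_near_le {Δ ρ τ : ℝ} {s ℓ : ℕ} {x : Fin s → ℝ}
    (hx : IsClustered Δ ρ s ℓ τ x) {r : ℝ} (h : 2 * r ≤ ρ ∨ ℓ = s) (t : ℝ) :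
    ((Finset.univ.image x).filter fun u => |t - u| < r).card ≤ ℓ := by
  rw [Finset.filter_image]
  refine Finset.card_image_le.trans ?_
  rcases h with h | rfl
  · rcases (Finset.univ.filter fun j => |t - x j| < r).eq_empty_or_nonempty with he | ⟨j, hj⟩
    · simp [he]
    · obtain ⟨c, -, hc, -, hfar⟩ := hx.cluster j
      refine (Finset.card_le_card fun i hi => ?_).trans hc
      by_contra hic
      have hd := hfar i hic
      rw [wrapDist_of_mem_Ioc (hx.mem_Ioc i) (hx.mem_Ioc j)] at hd
      have h1 : |t - x i| < r := (Finset.mem_filter.mp hi).2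
      have h2 : |t - x j| < r := (Finset.mem_filter.mp hj).2
      have h3 := abs_sub_le (x i) t (x j)
      rw [abs_sub_comm (x i) t] at h3
      linarith
  · exact (Finset.card_filter_le _ _).trans (by simp)

theorem support_sum_single_subset {s : ℕ} (x : Fin s → ℝ) (a : Fin s → ℂ) :
    (∑ j, Finsupp.single (x j) (a j)).support ⊆ Finset.univ.image x := by
  refine Finsupp.support_finsetSum.trans (Finset.biUnion_subset.mpr fun j _ => ?_)
  refine Finsupp.support_single_subset.trans ?_
  simp

/-! ### The upper bound -/

/-- Two measures of the class whose data agree up to `δ` have amplitudes that agree up to a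
multiple of `SRF ^ (2 ℓ - 1) δ`. Here `2 ℓ - 1` is the largest number of nodes of the two
configurations, other than a given node, that can lie within a distance of order `1 / Ω` of it. -/
theorem coeffNorm_sub_le {Δ ρ τ : ℝ} {s ℓ : ℕ} {μ ν : PointMeasure}
    (hμ : μ ∈ clusteredClass Δ ρ s ℓ τ) (hν : ν ∈ clusteredClass Δ ρ s ℓ τ) {Ω : ℝ}
    (hΩ : 0 < Ω) (hSRF : 1 ≤ SRF Δ Ω)
    (hρ : 2 * (2 * (s + 1) * Real.pi / Ω) ≤ ρ ∨ ℓ = s) :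
    coeffNorm (μ - ν) ≤ (2 * s) *
      (2 ^ (2 * s) * ((s + 1) * SRF Δ Ω) ^ (2 * ℓ - 1) * ‖bandFourier (μ - ν) Ω‖) := by
  obtain ⟨x, a, hxg, hx, rfl⟩ := hμ
  obtain ⟨y, b, hyg, hy, rfl⟩ := hν
  have hπ := Real.pi_pos
  have hΔ := hx.delta_pos
  set ν' := ∑ j, Finsupp.single (x j) (a j) - ∑ j, Finsupp.single (y j) (b j) with hν'
  set X := Finset.univ.image x
  set Y := Finset.univ.image y
  have hX : X.card ≤ s := Finset.card_image_le.trans (by simp)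
  have hY : Y.card ≤ s := Finset.card_image_le.trans (by simp)
  have hcard : (X ∪ Y).card ≤ 2 * s := (Finset.card_union_le X Y).trans (by omega)
  have hsupp : ν'.support ⊆ X ∪ Y :=
    Finsupp.support_sub.trans (Finset.union_subset_union
      (support_sum_single_subset x a) (support_sum_single_subset y b))
  have hgrid : ∀ u ∈ X ∪ Y, u ∈ grid Δ := fun u hu => by
    rcases Finset.mem_union.mp hu with hu | hu <;>
      obtain ⟨j, -, rfl⟩ := Finset.mem_image.mp hu
    exacts [hxg j, hyg j]
  set A := (s + 1) * SRF Δ Ω with hA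
  have hA1 : 1 ≤ A := one_le_mul_of_one_le_of_one_le (by simp) hSRF
  have hA0 : 0 < A := by linarith
  have hbound : ∀ t ∈ ν'.support,
      ‖ν' t‖ ≤ 2 ^ (2 * s) * A ^ (2 * ℓ - 1) * ‖bandFourier ν' Ω‖ := fun t ht => by
    have htN := hsupp ht
    have hnear : (((X ∪ Y).erase t).filter
        fun u => |t - u| < 2 * (s + 1) * Real.pi / Ω).card ≤ 2 * ℓ - 1 := by
      have hr : 0 < 2 * (s + 1) * Real.pi / Ω := by positivity
      rw [Finset.filter_erase, Finset.card_erase_of_mem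
        (Finset.mem_filter.mpr ⟨htN, by simpa using hr⟩), Finset.filter_union]
      have h1 : (X.filter _).card ≤ ℓ := hx.card_near_le hρ t
      have h2 : (Y.filter _).card ≤ ℓ := hy.card_near_le hρ t
      have h3 := Finset.card_union_le (X.filter fun u => |t - u| < 2 * (s + 1) * Real.pi / Ω)
        (Y.filter fun u => |t - u| < 2 * (s + 1) * Real.pi / Ω)
      omega
    have h := norm_apply_le_of_card_near_le (m := 2 * (s + 1)) (Δ := Δ) (q := A⁻¹)
      hsupp htN hΩ (by positivity)
      (by have : ((X ∪ Y).card : ℝ) ≤ 2 * s := by exact_mod_cast hcard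
          linarith)
      (fun u hu hut => le_abs_sub_of_mem_grid hΔ (hgrid t htN) (hgrid u hu) hut)
      (by positivity) (inv_le_one_of_one_le₀ hA1)
      (le_of_eq (by rw [hA, SRF]; field_simp)) hnear
    rw [inv_pow, ← div_eq_mul_inv, div_le_iff₀ (by positivity)] at h
    refine h.trans ?_
    rw [mul_right_comm]
    gcongr
    norm_num
  have := coeffNorm_le_of_forall_norm_apply_le (by positivity)
    ((Finset.card_le_card hsupp).trans hcard) hbound
  simpa using this

/-- The estimator that returns any measure of the class consistent with the data has worst-case
error at most the modulus of continuity at `2 ε`. -/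
theorem minimaxError_le {R : Set PointMeasure} (hR : R.Nonempty) {Ω ε B : ℝ}
    (h : ∀ μ ∈ R, ∀ ν ∈ R, ‖bandFourier (μ - ν) Ω‖ ≤ 2 * ε → coeffNorm (μ - ν) ≤ B) :
    minimaxError R Ω ε ≤ ENNReal.ofReal B := by
  classical
  obtain ⟨μ₀, hμ₀⟩ := hR
  have hex : ∀ y : Band Ω, ∃ μ : R, (∃ ν ∈ R, ‖bandFourier ν Ω - y‖ ≤ ε) →
      ‖bandFourier μ Ω - y‖ ≤ ε := fun y => by
    by_cases hy : ∃ ν ∈ R, ‖bandFourier ν Ω - y‖ ≤ ε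
    · obtain ⟨ν, hν, hνy⟩ := hy
      exact ⟨⟨ν, hν⟩, fun _ => hνy⟩
    · exact ⟨⟨μ₀, hμ₀⟩, fun hc => absurd hc hy⟩
  choose est hest using hex
  refine iInf_le_of_le est (iSup₂_le fun μ hμ => iSup₂_le fun e he => ?_)
  refine ENNReal.ofReal_le_ofReal (h _ (est _).2 μ hμ ?_)
  have h1 := hest (bandFourier μ Ω + e) ⟨μ, hμ, by simpa using he⟩
  rw [bandFourier_sub]
  calc _ = ‖(bandFourier (est (bandFourier μ Ω + e)) Ω - (bandFourier μ Ω + e)) + e‖ := by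
        congr 1
        abel
    _ ≤ _ := (norm_add_le _ _).trans (by linarith)

/-! ### Two-point lower bound -/

/-- Two measures of the class with nearly equal data cannot both be recovered: the data of the
first one are also noisy data of the second one. -/
theorem le_minimaxError {R : Set PointMeasure} {μ ν : PointMeasure} (hμ : μ ∈ R) (hν : ν ∈ R)
    {Ω ε B t : ℝ} (hε : ‖bandFourier (μ - ν) Ω‖ ≤ ε) (hB : 2 * B ≤ ‖μ t - ν t‖) :
    ENNReal.ofReal B ≤ minimaxError R Ω ε := by
  have hε0 : 0 ≤ ε := (norm_nonneg _).trans hε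
  rw [bandFourier_sub] at hε
  refine le_iInf fun est => ?_
  set κ : PointMeasure := (est (bandFourier μ Ω)).1
  by_cases h : B ≤ ‖(κ - μ) t‖
  · refine le_trans ?_ (le_iSup₂_of_le μ hμ (le_iSup₂_of_le 0 (by simpa using hε0) le_rfl))
    rw [add_zero]
    exact ENNReal.ofReal_le_ofReal (h.trans (norm_apply_le_coeffNorm _ t))
  · refine le_trans ?_ (le_iSup₂_of_le ν hν (le_iSup₂_of_le _ hε le_rfl))
    rw [add_sub_cancel]
    refine ENNReal.ofReal_le_ofReal (le_trans ?_ (norm_apply_le_coeffNorm _ t))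
    rw [Finsupp.sub_apply] at h ⊢
    have := norm_sub_le_norm_sub_add_norm_sub (μ t) (κ t) (ν t)
    rw [norm_sub_rev (μ t) (κ t)] at this
    linarith

theorem norm_bandFourier_le (μ : PointMeasure) {Ω B : ℝ} (hΩ : 0 < Ω) (hB : 0 ≤ B)
    (h : ∀ ω ∈ Icc (-Ω) Ω, ‖fourier μ ω‖ ≤ B) : ‖bandFourier μ Ω‖ ≤ B := by
  refine le_of_sq_le_sq ?_ hB
  rw [bandFourier_norm_sq μ hΩ]
  calc _ ≤ 1 / (2 * Ω) * ∫ _ω in (-Ω)..Ω, B ^ 2 := by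
        refine mul_le_mul_of_nonneg_left ?_ (by positivity)
        exact intervalIntegral.integral_mono_on (by linarith)
          (((continuous_fourier μ).norm.pow 2).intervalIntegrable _ _)
          (continuous_const.intervalIntegrable _ _)
          fun ω hω => pow_le_pow_left₀ (norm_nonneg _) (h ω hω) 2
    _ = B ^ 2 := by
        rw [intervalIntegral.integral_const, smul_eq_mul]
        field_simp
        ring

/-! ### Configurations with one large cluster -/

/-- A measure carried by a set `S` of at most `ℓ` grid nodes of bounded diameter belongs to the
class as soon as `S` extends to a configuration of `s` nodes in which all the other distances are
at least `ρ`; the additional nodes carry zero amplitudes. -/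
theorem mem_clusteredClass_of_support_subset {Δ ρ τ : ℝ} {s ℓ : ℕ} (hΔ : 0 < Δ) (hℓ : 2 ≤ ℓ)
    (hs : ℓ ≤ s) (hτ : (ℓ : ℝ) - 1 ≤ τ) (hτΔ : τ < Real.pi / Δ) (hρ : 0 ≤ ρ) {S T : Finset ℤ}
    (hT : T.card = s) (hST : S ⊆ T) (hS : S.card ≤ ℓ)
    (hgrid : ∀ k ∈ T, (k * Δ : ℝ) ∈ grid Δ ∩ Ioc (-(Real.pi / 2)) (Real.pi / 2))
    (hnear : ∀ j ∈ S, ∀ k ∈ S, |(j : ℝ) - k| ≤ τ)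
    (hfar : ∀ j ∈ T, ∀ k ∈ T, j ≠ k → ¬(j ∈ S ∧ k ∈ S) → ρ ≤ |(j : ℝ) - k| * Δ)
    {μ : PointMeasure} (hμ : μ.support ⊆ S.image fun k : ℤ => (k * Δ : ℝ)) :
    μ ∈ clusteredClass Δ ρ s ℓ τ := by
  classical
  set e := T.equivFinOfCardEq hT
  have hinj : Function.Injective fun k : ℤ => (k * Δ : ℝ) := fun j k h => by
    exact_mod_cast mul_right_cancel₀ hΔ.ne' h
  have hmem : ∀ j : Fin s, ((e.symm j : ℤ) * Δ : ℝ) ∈ Ioc (-(Real.pi / 2)) (Real.pi / 2) :=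
    fun j => (hgrid _ (e.symm j).2).2
  have hdist : ∀ i j : Fin s, wrapDist ((e.symm i : ℤ) * Δ - (e.symm j : ℤ) * Δ) =
      |((e.symm i : ℤ) : ℝ) - (e.symm j : ℤ)| * Δ := fun i j => by
    rw [wrapDist_of_mem_Ioc (hmem i) (hmem j), ← sub_mul, abs_mul, abs_of_pos hΔ]
  have hne : ∀ {i j : Fin s}, i ≠ j → (e.symm i : ℤ) ≠ e.symm j := fun h h' =>
    h (e.symm.injective (Subtype.ext h'))
  refine ⟨fun j => (e.symm j : ℤ) * Δ, fun j => μ ((e.symm j : ℤ) * Δ),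
    fun j => (hgrid _ (e.symm j).2).1, ⟨hΔ, hℓ, hs, hτ, hτΔ, hρ, ?_, hmem, fun j => ?_⟩, ?_⟩
  · exact hinj.comp (Subtype.val_injective.comp e.symm.injective)
  · by_cases hj : (e.symm j : ℤ) ∈ S
    · refine ⟨Finset.univ.filter fun i => (e.symm i : ℤ) ∈ S, by simpa using hj, ?_, ?_, ?_⟩
      · refine (Finset.card_le_card_of_injOn (t := S) (fun i => (e.symm i : ℤ)) ?_ ?_).trans hS
        · intro i hi
          simpa using hi
        · exact (Subtype.val_injective.comp e.symm.injective).injOn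
      · intro i hi hij
        rw [hdist]
        refine ⟨le_mul_of_one_le_left hΔ.le ?_, ?_⟩
        · exact_mod_cast Int.one_le_abs (sub_ne_zero.mpr (hne hij))
        · gcongr
          exact hnear _ (by simpa using hi) _ hj
      · intro i hi
        rw [hdist]
        have hi' : (e.symm i : ℤ) ∉ S := by simpa using hi
        exact hfar _ (e.symm i).2 _ (e.symm j).2 (fun h => hi' (h ▸ hj)) fun h => hi' h.1
    · refine ⟨{j}, by simp, by simp; omega, ?_, ?_⟩
      · intro i hi hij
        exact absurd (Finset.mem_singleton.mp hi) hij
      · intro i hi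
        rw [hdist]
        exact hfar _ (e.symm i).2 _ (e.symm j).2 (hne (by simpa using hi)) fun h => hj h.2
  · have h1 : μ = ∑ t ∈ T.image fun k : ℤ => (k * Δ : ℝ), Finsupp.single t (μ t) := by
      conv_lhs => rw [← Finsupp.sum_single μ]
      exact Finsupp.sum_of_support_subset _
        (hμ.trans (Finset.image_subset_image hST)) _ (by simp)
    rw [Finset.sum_image hinj.injOn, ← Finset.sum_coe_sort] at h1
    exact h1.trans (Equiv.sum_comp e.symm
      fun k : T => Finsupp.single ((k : ℤ) * Δ : ℝ) (μ ((k : ℤ) * Δ))).symm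

/-- Completing a block `S` of `ℓ` integers to `s` integers with large mutual distances. If `K` is
small compared with `ℓ s`, distance `1` is large enough, and any completion inside `G` will do;
otherwise multiples of `K / s` are added. -/
theorem exists_spread_superset {s ℓ : ℕ} (hℓ : 2 ≤ ℓ) (hs : ℓ ≤ s) {K : ℤ} {S G : Finset ℤ}
    (hS : S ⊆ Finset.Icc 0 (2 * ℓ - 1)) (hcard : S.card = ℓ) (hSG : S ⊆ G)
    (hKG : Finset.Icc 0 K ⊆ G) (hG : s ≤ G.card) :
    ∃ T : Finset ℤ, S ⊆ T ∧ T ⊆ G ∧ T.card = s ∧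
      ∀ j ∈ T, ∀ k ∈ T, j ≠ k → ¬(j ∈ S ∧ k ∈ S) → K + 1 ≤ 8 * ℓ * s * |j - k| := by
  have hℓ' : (2 : ℤ) ≤ ℓ := by exact_mod_cast hℓ
  have hs' : (ℓ : ℤ) ≤ s := by exact_mod_cast hs
  rcases lt_or_ge K (4 * ℓ * s) with hK | hK
  · obtain ⟨T, hST, hTG, hT⟩ := Finset.exists_subsuperset_card_eq hSG (hcard.trans_le hs) hG
    refine ⟨T, hST, hTG, hT, fun j _ k _ hjk _ => ?_⟩
    have h1 : 1 ≤ |j - k| := Int.one_le_abs (sub_ne_zero.mpr hjk)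
    nlinarith [mul_nonneg (show (0 : ℤ) ≤ ℓ by omega) (show (0 : ℤ) ≤ s by omega)]
  · set L : ℤ := K / s with hL
    have hs0 : (0 : ℤ) < s := by omega
    have hL4 : 4 * ℓ ≤ L := (Int.le_ediv_iff_mul_le hs0).mpr hK
    have hLs : L * s ≤ K := Int.ediv_mul_le K hs0.ne'
    have hKL : K + 1 ≤ 2 * s * L := by
      have := Int.lt_ediv_add_one_mul_self K hs0
      nlinarith
    have hinj : Function.Injective fun i : ℕ => ((i : ℤ) + 1) * L := fun i j h => by
      have := mul_right_cancel₀ (show L ≠ 0 by omega) h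
      omega
    have hbig : ∀ i : ℕ, L ≤ ((i : ℤ) + 1) * L := fun i => by nlinarith
    have hSle : ∀ {k}, k ∈ S → 0 ≤ k ∧ k ≤ 2 * ℓ - 1 := fun hk => Finset.mem_Icc.mp (hS hk)
    refine ⟨S ∪ (Finset.range (s - ℓ)).image fun i : ℕ => ((i : ℤ) + 1) * L,
      Finset.subset_union_left, Finset.union_subset hSG ?_, ?_, ?_⟩
    · refine fun k hk => hKG ?_
      obtain ⟨i, hi, rfl⟩ := Finset.mem_image.mp hk
      have hi' : (i : ℤ) + 1 ≤ s := by
        have := Finset.mem_range.mp hi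
        omega
      have := hbig i
      exact Finset.mem_Icc.mpr ⟨by omega, by nlinarith⟩
    · rw [Finset.card_union_of_disjoint, hcard, Finset.card_image_of_injective _ hinj,
        Finset.card_range]
      · omega
      · rw [Finset.disjoint_left]
        intro k hk hk'
        obtain ⟨i, -, rfl⟩ := Finset.mem_image.mp hk'
        have := hbig i
        have := hSle hk
        omega
    · intro j hj k hk hjk hjkS
      have hgap : L ≤ 2 * |j - k| := by
        rcases Finset.mem_union.mp hj with hj | hj <;> rcases Finset.mem_union.mp hk with hk | hk
        · exact absurd ⟨hj, hk⟩ hjkS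
        · obtain ⟨i, -, rfl⟩ := Finset.mem_image.mp hk
          have := hbig i
          have := hSle hj
          have := neg_le_abs (j - ((i : ℤ) + 1) * L)
          omega
        · obtain ⟨i, -, rfl⟩ := Finset.mem_image.mp hj
          have := hbig i
          have := hSle hk
          have := le_abs_self (((i : ℤ) + 1) * L - k)
          omega
        · obtain ⟨i, -, rfl⟩ := Finset.mem_image.mp hj
          obtain ⟨i', -, rfl⟩ := Finset.mem_image.mp hk
          have hii : (i : ℤ) - i' ≠ 0 := fun h => hjk (by rw [sub_eq_zero.mp h])
          have h1 := Int.one_le_abs hii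
          have h2 : ((i : ℤ) + 1) * L - ((i' : ℤ) + 1) * L = (i - i') * L := by ring
          rw [h2, abs_mul, abs_of_pos (show 0 < L by omega)]
          nlinarith
      have hsa : (0 : ℤ) ≤ s * |j - k| := by positivity
      nlinarith

theorem exists_clustered_superset {Δ : ℝ} {s ℓ : ℕ} (hΔ : 0 < Δ) (hℓ : 2 ≤ ℓ) (hs : ℓ ≤ s)
    (hΔℓ : Δ < Real.pi / (2 * (2 * (ℓ : ℝ) - 1)))
    (hcardG : s ≤ (grid Δ ∩ Ioc (-(Real.pi / 2)) (Real.pi / 2)).ncard) {S : Finset ℤ}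
    (hS : S ⊆ Finset.Icc 0 (2 * ℓ - 1)) (hcard : S.card = ℓ) :
    ∃ T : Finset ℤ, S ⊆ T ∧ T.card = s ∧
      (∀ k ∈ T, (k * Δ : ℝ) ∈ grid Δ ∩ Ioc (-(Real.pi / 2)) (Real.pi / 2)) ∧
      ∀ j ∈ T, ∀ k ∈ T, j ≠ k → ¬(j ∈ S ∧ k ∈ S) →
        Real.pi / (16 * ℓ * s) ≤ |(j : ℝ) - k| * Δ := by
  classical
  have hπ := Real.pi_pos
  have hℓ' : (2 : ℝ) ≤ ℓ := by exact_mod_cast hℓ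
  have hs' : (ℓ : ℝ) ≤ s := by exact_mod_cast hs
  set K : ℤ := ⌊Real.pi / (2 * Δ)⌋ with hK
  have hKle : (K : ℝ) ≤ Real.pi / (2 * Δ) := Int.floor_le _
  have hKlt : Real.pi / (2 * Δ) < K + 1 := Int.lt_floor_add_one _
  have hKℓ : 2 * (ℓ : ℤ) - 1 ≤ K := by
    rw [hK, Int.le_floor]
    push_cast
    rw [lt_div_iff₀ (by linarith)] at hΔℓ
    rw [le_div_iff₀ (by positivity)]
    linarith
  set G : Finset ℤ := (Finset.Icc (-K) K).filter
    fun k => (k * Δ : ℝ) ∈ Ioc (-(Real.pi / 2)) (Real.pi / 2) with hGdef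
  have hGmem : ∀ k ∈ G, (k * Δ : ℝ) ∈ grid Δ ∩ Ioc (-(Real.pi / 2)) (Real.pi / 2) :=
    fun k hk => by
      obtain ⟨h1, h2⟩ := Finset.mem_filter.mp hk
      obtain ⟨h3, h4⟩ := Finset.mem_Icc.mp h1
      exact ⟨⟨k, h3, h4, rfl⟩, h2⟩
  have hG : s ≤ G.card := by
    have hsub : grid Δ ∩ Ioc (-(Real.pi / 2)) (Real.pi / 2) ⊆
        ((G.image fun k : ℤ => (k * Δ : ℝ) : Finset ℝ) : Set ℝ) := by
      rintro _ ⟨⟨k, h1, h2, rfl⟩, h3⟩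
      refine Finset.mem_coe.mpr (Finset.mem_image_of_mem _ ?_)
      exact Finset.mem_filter.mpr ⟨Finset.mem_Icc.mpr ⟨h1, h2⟩, h3⟩
    have := Set.ncard_le_ncard hsub (Finset.finite_toSet _)
    rw [Set.ncard_coe_finset] at this
    exact (hcardG.trans this).trans Finset.card_image_le
  have hKG : Finset.Icc 0 K ⊆ G := fun k hk => by
    obtain ⟨h1, h2⟩ := Finset.mem_Icc.mp hk
    have h1' : (0 : ℝ) ≤ k := by exact_mod_cast h1
    have h2' : (k : ℝ) ≤ Real.pi / (2 * Δ) := le_trans (by exact_mod_cast h2) hKle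
    refine Finset.mem_filter.mpr ⟨Finset.mem_Icc.mpr ⟨by omega, h2⟩, ?_, ?_⟩
    · nlinarith
    · rw [le_div_iff₀ (by positivity)] at h2'
      linarith
  have hSG : S ⊆ G := hS.trans ((Finset.Icc_subset_Icc_right hKℓ).trans hKG)
  obtain ⟨T, hST, hTG, hT, hspread⟩ := exists_spread_superset hℓ hs hS hcard hSG hKG hG
  refine ⟨T, hST, hT, fun k hk => hGmem k (hTG hk), fun j hj k hk hjk hjkS => ?_⟩
  have h1 : (K : ℝ) + 1 ≤ 8 * ℓ * s * |(j : ℝ) - k| := by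
    exact_mod_cast hspread j hj k hk hjk hjkS
  have h2 := hKlt.trans_le h1
  rw [div_lt_iff₀ (by positivity)] at h2
  rw [div_le_iff₀ (by nlinarith)]
  linarith

/-! ### Two measures with almost equal data -/

theorem fourier_sum_single {ι : Type*} (I : Finset ι) (x : ι → ℝ) (a : ι → ℂ) (ω : ℝ) :
    fourier (∑ i ∈ I, Finsupp.single (x i) (a i)) ω =
      ∑ i ∈ I, a i * Complex.exp (Complex.I * ω * x i) := by
  rw [fourier, ← Finsupp.sum_finsetSum_index (by simp) (by intros; ring)]
  exact Finset.sum_congr rfl fun i _ => Finsupp.sum_single_index (by simp)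

/-- The part of `∑ n < 2 ℓ, w n • δ_(n Δ)` carried by the indices `n` of the parity of
`r ∈ {0, 1}`. -/
def parityPart (Δ : ℝ) (ℓ : ℕ) (w : ℕ → ℂ) (r : ℕ) : PointMeasure :=
  ∑ i ∈ Finset.range ℓ, Finsupp.single ((2 * i + r : ℕ) * Δ) (w (2 * i + r))

/-- The integers `r, r + 2, …, r + 2 (ℓ - 1)`. -/
def parityBlock (ℓ r : ℕ) : Finset ℤ :=
  (Finset.range ℓ).image fun i : ℕ => ((2 * i + r : ℕ) : ℤ)

theorem card_parityBlock (ℓ r : ℕ) : (parityBlock ℓ r).card = ℓ := by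
  rw [parityBlock, Finset.card_image_of_injective, Finset.card_range]
  intro i j h
  simp only [Nat.cast_inj] at h
  omega

theorem parityBlock_subset {ℓ r : ℕ} (hr : r ≤ 1) :
    parityBlock ℓ r ⊆ Finset.Icc 0 (2 * ℓ - 1) := fun k hk => by
  obtain ⟨i, hi, rfl⟩ := Finset.mem_image.mp hk
  have := Finset.mem_range.mp hi
  exact Finset.mem_Icc.mpr ⟨by omega, by push_cast; omega⟩

theorem abs_sub_le_of_mem_parityBlock {ℓ r : ℕ} {j k : ℤ} (hj : j ∈ parityBlock ℓ r)
    (hk : k ∈ parityBlock ℓ r) : |(j : ℝ) - k| ≤ 2 * ℓ - 2 := by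
  obtain ⟨i, hi, rfl⟩ := Finset.mem_image.mp hj
  obtain ⟨i', hi', rfl⟩ := Finset.mem_image.mp hk
  have h1 : (i : ℝ) + 1 ≤ ℓ := by exact_mod_cast Finset.mem_range.mp hi
  have h2 : (i' : ℝ) + 1 ≤ ℓ := by exact_mod_cast Finset.mem_range.mp hi'
  have h3 : (0 : ℝ) ≤ i := i.cast_nonneg
  have h4 : (0 : ℝ) ≤ i' := i'.cast_nonneg
  push_cast
  rw [abs_le]
  constructor <;> linarith

theorem support_parityPart_subset (Δ : ℝ) (ℓ : ℕ) (w : ℕ → ℂ) (r : ℕ) :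
    (parityPart Δ ℓ w r).support ⊆ (parityBlock ℓ r).image fun k : ℤ => (k * Δ : ℝ) := by
  refine Finsupp.support_finsetSum.trans (Finset.biUnion_subset.mpr fun i hi => ?_)
  refine Finsupp.support_single_subset.trans (Finset.singleton_subset_iff.mpr ?_)
  exact Finset.mem_image.mpr ⟨_, Finset.mem_image_of_mem _ hi, by simp⟩

theorem parityPart_mem_clusteredClass {Δ : ℝ} {s ℓ : ℕ} (hΔ : 0 < Δ) (hℓ : 2 ≤ ℓ) (hs : ℓ ≤ s)
    (hΔℓ : Δ < Real.pi / (2 * (2 * (ℓ : ℝ) - 1)))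
    (hcardG : s ≤ (grid Δ ∩ Ioc (-(Real.pi / 2)) (Real.pi / 2)).ncard) (w : ℕ → ℂ) {r : ℕ}
    (hr : r ≤ 1) :
    parityPart Δ ℓ w r ∈ clusteredClass Δ (Real.pi / (16 * ℓ * s)) s ℓ (2 * ℓ - 2) := by
  have hℓ' : (2 : ℝ) ≤ ℓ := by exact_mod_cast hℓ
  have hπ := Real.pi_pos
  obtain ⟨T, hST, hT, hgrid, hfar⟩ := exists_clustered_superset hΔ hℓ hs hΔℓ hcardG
    (parityBlock_subset hr) (card_parityBlock ℓ r)
  refine mem_clusteredClass_of_support_subset hΔ hℓ hs (by linarith) ?_ (by positivity) hT hST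
    (card_parityBlock ℓ r).le hgrid (fun j hj k hk => abs_sub_le_of_mem_parityBlock hj hk) hfar
    (support_parityPart_subset Δ ℓ w r)
  rw [lt_div_iff₀ (by linarith)] at hΔℓ
  rw [lt_div_iff₀ hΔ]
  nlinarith

theorem sum_range_two_mul {M : Type*} [AddCommMonoid M] (f : ℕ → M) (n : ℕ) :
    ∑ i ∈ Finset.range (2 * n), f i = ∑ i ∈ Finset.range n, (f (2 * i) + f (2 * i + 1)) := by
  induction n with
  | zero => simp
  | succ n ih => rw [Finset.sum_range_succ _ n, ← ih, mul_add, mul_one, Finset.sum_range_succ,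
      Finset.sum_range_succ, add_assoc]

/-- The coefficients of `c (1 - X) ^ (2 ℓ - 1)`. -/
def alternatingWeight (ℓ : ℕ) (c : ℂ) (n : ℕ) : ℂ := c * ((-1) ^ n * (2 * ℓ - 1).choose n)

theorem fourier_parityPart_sub {ℓ : ℕ} (hℓ : 1 ≤ ℓ) (Δ : ℝ) (c : ℂ) (ω : ℝ) :
    fourier (parityPart Δ ℓ (alternatingWeight ℓ c) 0 -
        parityPart Δ ℓ (-alternatingWeight ℓ c) 1) ω =
      c * (1 - Complex.exp (Complex.I * (ω * Δ : ℝ))) ^ (2 * ℓ - 1) := by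
  set z := Complex.exp (Complex.I * (ω * Δ : ℝ)) with hz
  have hexp : ∀ n : ℕ, Complex.exp (Complex.I * ω * ((n * Δ : ℝ) : ℂ)) = z ^ n := fun n => by
    rw [hz, ← Complex.exp_nat_mul]
    congr 1
    push_cast
    ring
  rw [fourier_sub, Pi.sub_apply, parityPart, parityPart, fourier_sum_single, fourier_sum_single]
  simp only [hexp]
  rw [← Finset.sum_sub_distrib, sub_eq_neg_add 1 z, add_pow,
    show 2 * ℓ - 1 + 1 = 2 * ℓ by omega, sum_range_two_mul, Finset.mul_sum]
  refine Finset.sum_congr rfl fun i _ => ?_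
  simp only [alternatingWeight, Pi.neg_apply, add_zero, one_pow, mul_one, neg_pow z]
  ring

theorem parityPart_zero_apply_zero {ℓ : ℕ} (hℓ : 1 ≤ ℓ) {Δ : ℝ} (hΔ : 0 < Δ) (w : ℕ → ℂ) :
    parityPart Δ ℓ w 0 0 = w 0 := by
  rw [parityPart, Finsupp.finsetSum_apply,
    Finset.sum_eq_single_of_mem 0 (Finset.mem_range.mpr hℓ)]
  · simp
  · intro i _ hi
    refine Finsupp.single_eq_of_ne (Ne.symm (mul_ne_zero ?_ hΔ.ne'))
    exact_mod_cast (show 2 * i + 0 ≠ 0 by omega)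

theorem parityPart_one_apply_zero {ℓ : ℕ} {Δ : ℝ} (hΔ : 0 < Δ) (w : ℕ → ℂ) :
    parityPart Δ ℓ w 1 0 = 0 := by
  rw [parityPart, Finsupp.finsetSum_apply]
  refine Finset.sum_eq_zero fun i _ => Finsupp.single_eq_of_ne (Ne.symm (mul_ne_zero ?_ hΔ.ne'))
  exact_mod_cast (show 2 * i + 1 ≠ 0 by omega)

theorem le_minimaxError_clusteredClass {Δ : ℝ} {s ℓ : ℕ} (hΔ : 0 < Δ) (hℓ : 2 ≤ ℓ) (hs : ℓ ≤ s)
    (hΔℓ : Δ < Real.pi / (2 * (2 * (ℓ : ℝ) - 1)))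
    (hcardG : s ≤ (grid Δ ∩ Ioc (-(Real.pi / 2)) (Real.pi / 2)).ncard) {ε Ω : ℝ} (hε : 0 < ε)
    (hΩ : 0 < Ω) :
    ENNReal.ofReal (1 / (2 * Real.pi ^ (2 * ℓ - 1)) * SRF Δ Ω ^ (2 * ℓ - 1) * ε) ≤
      minimaxError (clusteredClass Δ (Real.pi / (16 * ℓ * s)) s ℓ (2 * ℓ - 2)) Ω ε := by
  have hπ := Real.pi_pos
  -- This amplitude makes the data of the difference, at most `c (Ω Δ) ^ (2 ℓ - 1)`, equal to `ε`.
  set c : ℝ := ε / (Δ * Ω) ^ (2 * ℓ - 1) with hc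
  have hc0 : 0 ≤ c := by positivity
  refine le_minimaxError (t := 0)
    (parityPart_mem_clusteredClass hΔ hℓ hs hΔℓ hcardG (alternatingWeight ℓ c) zero_le_one)
    (parityPart_mem_clusteredClass hΔ hℓ hs hΔℓ hcardG (-alternatingWeight ℓ c) le_rfl) ?_ ?_
  · refine norm_bandFourier_le _ hΩ hε.le fun ω hω => ?_
    rw [fourier_parityPart_sub (by omega), norm_mul, norm_pow, norm_sub_rev, Complex.norm_real,
      Real.norm_of_nonneg hc0]
    have h1 : ‖Complex.exp (Complex.I * (ω * Δ : ℝ)) - 1‖ ≤ Δ * Ω := by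
      refine (Real.norm_exp_I_mul_ofReal_sub_one_le (x := ω * Δ)).trans ?_
      rw [Real.norm_eq_abs, abs_mul, abs_of_pos hΔ, mul_comm]
      gcongr
      exact abs_le.mpr hω
    calc c * _ ≤ c * (Δ * Ω) ^ (2 * ℓ - 1) := by gcongr
      _ = ε := by rw [hc]; field_simp
  · rw [parityPart_zero_apply_zero (by omega) hΔ, parityPart_one_apply_zero hΔ, sub_zero]
    simp only [alternatingWeight, pow_zero, Nat.choose_zero_right, Nat.cast_one, mul_one,
      Complex.norm_real, Real.norm_of_nonneg hc0]
    refine le_of_eq ?_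
    rw [hc, SRF, div_pow]
    field_simp

end SuperRes

end

theorem theorem3 :
    (∃ C : ℕ → ℕ → ℝ, (∀ s ℓ, 0 < C s ℓ) ∧
      ∀ s ℓ : ℕ, 2 ≤ ℓ → ℓ ≤ s → ∀ ε : ℝ, 0 < ε →
        ∀ ρ τ M : ℝ, 0 ≤ ρ → (0 < ρ ∨ ℓ = s) → (ℓ : ℝ) - 1 ≤ τ → Real.pi ≤ M →
          ∃ α : ℝ, M ≤ α ∧ ∀ᶠ Δ : ℝ in 𝓝[>] (0 : ℝ),
            (SuperRes.clusteredClass Δ ρ s ℓ τ).Nonempty →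
              ∀ Ω : ℝ, 0 < Ω → SuperRes.SRF Δ Ω = α →
                SuperRes.minimaxError (SuperRes.clusteredClass Δ ρ s ℓ τ) Ω ε ≤
                  ENNReal.ofReal (C s ℓ * SuperRes.SRF Δ Ω ^ (2 * ℓ - 1) * ε)) ∧
    (∃ β : ℝ, 1 < β ∧ ∃ C : ℕ → ℝ, (∀ ℓ, 0 < C ℓ) ∧
      ∀ s ℓ : ℕ, 2 ≤ ℓ → ℓ ≤ s →
        ∃ ρ' τ' : ℝ, 0 < ρ' ∧ (ℓ : ℝ) - 1 ≤ τ' ∧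
          ∀ Δ : ℝ, 0 < Δ → Δ < Real.pi / (2 * (2 * (ℓ : ℝ) - 1)) →
            s ≤ (SuperRes.grid Δ ∩ Ioc (-(Real.pi / 2)) (Real.pi / 2)).ncard →
              (SuperRes.clusteredClass Δ ρ' s ℓ τ').Nonempty ∧
              ∀ ε Ω : ℝ, 0 < ε → 0 < Ω → β < SuperRes.SRF Δ Ω →
                ENNReal.ofReal (C ℓ * SuperRes.SRF Δ Ω ^ (2 * ℓ - 1) * ε) ≤
                  SuperRes.minimaxError (SuperRes.clusteredClass Δ ρ' s ℓ τ') Ω ε) := by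
  have hπ := Real.pi_pos
  have hπ3 := Real.pi_gt_three
  constructor
  · refine ⟨fun s ℓ => (2 * s + 1) * (2 ^ (2 * s) * (s + 1) ^ (2 * ℓ - 1) * 2),
      fun s ℓ => by positivity, fun s ℓ hℓ hs ε hε ρ τ M hρ hρs hτ hM => ⟨M, le_rfl, ?_⟩⟩
    have hM0 : 0 < M := by linarith
    -- The constraint on `Δ` puts the scale `1 / Ω` below the cluster separation.
    have hsmall : ∀ᶠ Δ : ℝ in 𝓝[>] 0, 4 * (s + 1) * M * Δ ≤ ρ ∨ ℓ = s := by
      rcases hρs with hρ0 | h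
      · have ht : Tendsto (fun Δ : ℝ => 4 * (s + 1) * M * Δ) (𝓝[>] 0) (𝓝 0) := by
          refine tendsto_nhdsWithin_of_tendsto_nhds ?_
          have : Continuous fun Δ : ℝ => 4 * (s + 1) * M * Δ := by fun_prop
          simpa using this.tendsto 0
        filter_upwards [ht.eventually_le_const hρ0] with Δ h using Or.inl h
      · exact Eventually.of_forall fun _ => Or.inr h
    filter_upwards [hsmall, self_mem_nhdsWithin] with Δ hΔρ hΔ hne Ω hΩ hSRF
    have hΔ0 : 0 < Δ := hΔ
    have hscale : Real.pi / Ω = M * Δ := by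
      rw [← hSRF, SuperRes.SRF]
      field_simp
    refine SuperRes.minimaxError_le hne fun μ hμ ν hν hε' => ?_
    refine (SuperRes.coeffNorm_sub_le hμ hν hΩ (by rw [hSRF]; linarith) ?_).trans ?_
    · refine hΔρ.imp_left fun h => le_trans (le_of_eq ?_) h
      rw [mul_div_assoc, hscale]
      ring
    · have hS0 : 0 < SuperRes.SRF Δ Ω := hSRF ▸ hM0
      calc _ ≤ (2 * s + 1 : ℝ) * (2 ^ (2 * s) *
            ((s + 1) * SuperRes.SRF Δ Ω) ^ (2 * ℓ - 1) * (2 * ε)) := by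
            gcongr
            linarith
        _ = _ := by
            rw [mul_pow]
            ring
  · refine ⟨2, one_lt_two, fun ℓ => 1 / (2 * Real.pi ^ (2 * ℓ - 1)), fun ℓ => by positivity,
      fun s ℓ hℓ hs => ⟨Real.pi / (16 * ℓ * s), 2 * ℓ - 2, ?_, ?_, fun Δ hΔ hΔℓ hcard =>
        ⟨⟨_, SuperRes.parityPart_mem_clusteredClass hΔ hℓ hs hΔℓ hcard 0 zero_le_one⟩,
          fun ε Ω hε hΩ _ =>
            SuperRes.le_minimaxError_clusteredClass hΔ hℓ hs hΔℓ hcard hε hΩ⟩⟩⟩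
    · have h1 : (0 : ℝ) < ℓ := by exact_mod_cast (by omega : 0 < ℓ)
      have h2 : (0 : ℝ) < s := by exact_mod_cast (by omega : 0 < s)
      positivity
    · have : (2 : ℝ) ≤ ℓ := by exact_mod_cast hℓ
      linarith
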